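/- Let $V$ be a finite-dimensional real vector space, $\mathbb P=\mathbb P(V)$ its projective space with the quotient topology, $\pi\colon V\setminus\{0\}\to\mathbb P$ the projection, and $\mathbb P^*=\mathbb P(V^*)$ the dual projective space. The two line segments joining distinct points $\pi(u),\pi(v)$ are $\{\pi(\lambda u+\mu v):\lambda\mu\ge 0,\ (\lambda,\mu)\neq(0,0)\}$ and $\{\pi(\lambda u+\mu v):\lambda\mu\le 0,\ (\lambda,\mu)\ne(0,0)\}$. A subset $S$ of a projective space is *convex* if any two distinct points of $S$ are joined by a line segment contained in $S$ and some projective hyperplane is disjoint from $S$. A convex set $A$ is *irreducible* if $A=B\cap B'$ with $B,B'$ convex implies $A=B$ or $A=B'$. A set is *multi-convex* if it is the intersection of a nonempty family of convex sets; a multi-convex set $S\subseteq\mathbb P$ is *saturated* if for each $p\notin S$ there is an open convex set containing $S$ and not $p$. The *components* of a multi-convex set $C$ are its maximal convex subsets, and its *co-components* are the minimal convex sets containing $C$; write $\mathrm{comp}(C)$ and $\mathrm{cocomp}(C)$ for the families of these. For a convex set $D$ and $S\subseteq D$ let $$[S]_D=\bigcap\{N : N\text{ convex},\ S\subseteq N\subseteq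 D\}$$ be the convex hull of $S$ relative to $D$. For $S\subseteq\mathbb P$ let $\Phi(S)\subseteq\mathbb P^*$ be the set of points $q\in\mathbb P^*$ such that the complement in $\mathbb P$ of the hyperplane corresponding to $q$ is an irreducible convex set containing $S$; define $\Phi(T)\subseteq\mathbb P$ for $T\subseteq\mathbb P^*$ in the same way, with the hyperplanes of $\mathbb P^*$ corresponding to points of $\mathbb P$. Put $\mathrm{sat}(T)=\Phi(\Phi(T))$. **Theorem.** Let $C$ be a nonempty saturated multi-convex set in $\mathbb P$. Then $\Phi(C)$ is multi-convex, for every component $N$ of $C$ the set $\Phi(N)$ is convex and contains $\Phi(C)$, and the maps $$\mathrm{comp}(C)\to\mathrm{cocomp}(\Phi(C)),\quad N\mapsto[\Phi(C)]_{\Phi(N)},$$ $$\mathrm{cocomp}(\Phi(C))\to\mathrm{comp}(C),\quad M\mapsto\Phi(\mathrm{sat}(M)),$$ are well-defined, mutually inverse bijections. -/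

import Mathlib

open scoped LinearAlgebra.Projectivization

namespace ProjConvex

section General

variable {W : Type*} [AddCommGroup W] [Module ℝ W]

/-- The projective line segment of all points `π(a u + b v)` with `a b ≥ 0`, not both zero. It is
used for vectors `u`, `v` representing two distinct points, so that `a u + b v ≠ 0` is automatic. -/
def segmentPos (u v : W) : Set (ℙ ℝ W) :=
  {x | ∃ (a b : ℝ) (h : a • u + b • v ≠ 0),
    0 ≤ a * b ∧ (a ≠ 0 ∨ b ≠ 0) ∧ x = Projectivization.mk ℝ (a • u + b • v) h}

/-- The other projective line segment joining the points represented by `u` and `v`: the points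
`π(a u + b v)` with `a b ≤ 0`, not both zero. -/
def segmentNeg (u v : W) : Set (ℙ ℝ W) :=
  {x | ∃ (a b : ℝ) (h : a • u + b • v ≠ 0),
    a * b ≤ 0 ∧ (a ≠ 0 ∨ b ≠ 0) ∧ x = Projectivization.mk ℝ (a • u + b • v) h}

/-- Any two distinct points of `S` are joined by one of their two line segments inside `S`.
(Changing the representing vectors at most swaps the two segments.) -/
def IsSemiconvex (S : Set (ℙ ℝ W)) : Prop :=
  ∀ (u v : W) (hu : u ≠ 0) (hv : v ≠ 0),
    Projectivization.mk ℝ u hu ∈ S → Projectivization.mk ℝ v hv ∈ S →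
    Projectivization.mk ℝ u hu ≠ Projectivization.mk ℝ v hv →
    segmentPos u v ⊆ S ∨ segmentNeg u v ⊆ S

/-- A projective hyperplane: the points lying in a linear subspace of codimension one. -/
def IsHyperplane (h : Set (ℙ ℝ W)) : Prop :=
  ∃ H : Submodule ℝ W, Module.finrank ℝ (W ⧸ H) = 1 ∧ h = {x | x.submodule ≤ H}

/-- Projective convex sets: semiconvex sets avoiding some projective hyperplane. -/
def IsConvex (S : Set (ℙ ℝ W)) : Prop :=
  IsSemiconvex S ∧ ∃ h : Set (ℙ ℝ W), IsHyperplane h ∧ Disjoint h S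

/-- A convex set is irreducible if it is not the intersection of two other convex sets. -/
def IsIrreducibleConvex (A : Set (ℙ ℝ W)) : Prop :=
  IsConvex A ∧ ∀ B C : Set (ℙ ℝ W), IsConvex B → IsConvex C → A = B ∩ C → A = B ∨ A = C

/-- The convex hull of `S` relative to the convex set `C`. -/
def relHull (S C : Set (ℙ ℝ W)) : Set (ℙ ℝ W) :=
  ⋂₀ {N | IsConvex N ∧ S ⊆ N ∧ N ⊆ C}

/-- Multi-convex sets: intersections of nonempty families of convex sets. -/
def IsMultiConvex (S : Set (ℙ ℝ W)) : Prop :=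
  ∃ F : Set (Set (ℙ ℝ W)), F.Nonempty ∧ (∀ A ∈ F, IsConvex A) ∧ S = ⋂₀ F

/-- The components of `C`: its maximal convex subsets. -/
def comp (C : Set (ℙ ℝ W)) : Set (Set (ℙ ℝ W)) :=
  {N | Maximal (fun A => IsConvex A ∧ A ⊆ C) N}

/-- The co-components of `C`: the minimal convex sets containing `C`. -/
def coComp (C : Set (ℙ ℝ W)) : Set (Set (ℙ ℝ W)) :=
  {M | Minimal (fun A => IsConvex A ∧ C ⊆ A) M}

/-- The quotient topology on projective space, from the nonzero vectors. -/
noncomputable instance projTopology [TopologicalSpace W] : TopologicalSpace (ℙ ℝ W) :=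
  TopologicalSpace.coinduced (Projectivization.mk' ℝ : {w : W // w ≠ 0} → ℙ ℝ W) inferInstance

/-- A multi-convex set `S` is saturated if each point outside `S` is avoided by some open convex
set containing `S`. -/
def IsSaturatedMultiConvex [TopologicalSpace W] (S : Set (ℙ ℝ W)) : Prop :=
  IsMultiConvex S ∧ ∀ p, p ∉ S → ∃ U : Set (ℙ ℝ W), IsOpen U ∧ IsConvex U ∧ S ⊆ U ∧ p ∉ U

end General

section Duality

variable {V : Type*} [AddCommGroup V] [Module ℝ V]

/-- Incidence between a point `p` of `ℙ(V)` and a point `q` of the dual space `ℙ(V*)`: `p` lies on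
the hyperplane corresponding to `q`, equivalently `q` lies on the hyperplane corresponding
to `p`. -/
def Incident (p : ℙ ℝ V) (q : ℙ ℝ (Module.Dual ℝ V)) : Prop :=
  ∀ v ∈ p.submodule, ∀ f ∈ q.submodule, f v = 0

/-- `Φ` from subsets of `ℙ(V)` to subsets of `ℙ(V*)`: the points `q` corresponding to irreducible
convex sets `C` containing `S`, where `q` corresponds to `C` when `C` is the complement of the
hyperplane of `q`. -/
def Phi (S : Set (ℙ ℝ V)) : Set (ℙ ℝ (Module.Dual ℝ V)) :=
  {q | ∃ C : Set (ℙ ℝ V), IsIrreducibleConvex C ∧ S ⊆ C ∧ C = {p | ¬ Incident p q}}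

/-- `Φ` in the other direction, from subsets of `ℙ(V*)` to subsets of `ℙ(V)`. -/
def PhiDual (T : Set (ℙ ℝ (Module.Dual ℝ V))) : Set (ℙ ℝ V) :=
  {p | ∃ C : Set (ℙ ℝ (Module.Dual ℝ V)),
    IsIrreducibleConvex C ∧ T ⊆ C ∧ C = {q | ¬ Incident p q}}

/-- The saturation of a subset of the dual projective space. -/
def satDual (T : Set (ℙ ℝ (Module.Dual ℝ V))) : Set (ℙ ℝ (Module.Dual ℝ V)) :=
  Phi (PhiDual T)

end Duality

end ProjConvex

namespace ProjConvex

/-! ### Functionals, hyperplanes and segments. -/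

section General

variable {W W' : Type*} [AddCommGroup W] [Module ℝ W] [AddCommGroup W'] [Module ℝ W']

/-! Complements of hyperplanes are always irreducible convex sets, so `Phi S` consists of the
functionals vanishing nowhere on `S`. Hence `Phi` and `PhiDual` form an antitone Galois connection
(`subset_phi_iff`). Both send nonempty convex sets to nonempty convex sets, by a sign argument: if
`f` vanishes nowhere on a convex set, the sign of `f u * f v` tells which segment from `u` to `v`
stays in the set. Hahn–Banach gives `PhiDual (Phi C) = C` for saturated `C`.

Let `N` be a component of `C`. For any convex `M` with `Phi C ⊆ M ⊆ Phi N`, the set `PhiDual M` is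
convex and lies between `N` and `C`, so it equals `N` by maximality. The hull of `Phi C` in `Phi N`
is such an `M`, and it is a co-component.

Conversely, let `M` be a co-component of `Phi C` and let `N` be convex with `PhiDual M ⊆ N ⊆ C`.
Then `Phi N ∩ M` lies between `Phi C` and `M` and is convex because both factors lie in the convex
set `satDual M`. Minimality gives `M ⊆ Phi N`, that is `N ⊆ PhiDual M`, so `PhiDual M` is a
component. -/

lemma apply_rep_mk_eq_zero_iff (f : W →ₗ[ℝ] ℝ) (v : W) (hv : v ≠ 0) :
    f (Projectivization.mk ℝ v hv).rep = 0 ↔ f v = 0 := by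
  obtain ⟨a, ha⟩ := Projectivization.exists_smul_eq_mk_rep ℝ v hv
  rw [← ha, Units.smul_def, map_smul, smul_eq_mul]
  simp

lemma isHyperplane_iff (h : Set (ℙ ℝ W)) :
    IsHyperplane h ↔ ∃ g : W →ₗ[ℝ] ℝ, g ≠ 0 ∧ h = {x | g x.rep = 0} := by
  have key (g : W →ₗ[ℝ] ℝ) :
      {x : ℙ ℝ W | x.submodule ≤ LinearMap.ker g} = {x | g x.rep = 0} := by
    ext x
    simp [Projectivization.submodule_eq, Submodule.span_singleton_le_iff_mem]
  constructor
  · rintro ⟨H, hH, rfl⟩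
    have : Module.Finite ℝ (W ⧸ H) := Module.finite_of_finrank_eq_succ hH
    have e : (W ⧸ H) ≃ₗ[ℝ] ℝ := LinearEquiv.ofFinrankEq _ _ (by simpa using hH)
    refine ⟨e.toLinearMap ∘ₗ H.mkQ, fun h0 => ?_, ?_⟩
    · obtain ⟨y, hy⟩ := H.mkQ_surjective (e.symm 1)
      have := LinearMap.congr_fun h0 y
      simp [-Submodule.mkQ_apply, hy] at this
    · rw [← key]
      simp [LinearEquiv.ker_comp]
  · rintro ⟨g, hg, rfl⟩
    refine ⟨LinearMap.ker g, ?_, (key g).symm⟩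
    have hr : LinearMap.range g = ⊤ := LinearMap.range_eq_top.2 (LinearMap.surjective hg)
    rw [g.quotKerEquivRange.finrank_eq, hr]
    simp

lemma smul_add_smul_ne_zero {u v : W} (hu : u ≠ 0) (hv : v ≠ 0)
    (huv : Projectivization.mk ℝ u hu ≠ Projectivization.mk ℝ v hv) {a b : ℝ} (ha : a ≠ 0) :
    a • u + b • v ≠ 0 := by
  intro h
  apply huv
  rw [Projectivization.mk_eq_mk_iff']
  refine ⟨-(a⁻¹ * b), ?_⟩
  have h1 : a • u = -(b • v) := eq_neg_of_add_eq_zero_left h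
  have h2 : u = a⁻¹ • (a • u) := by rw [smul_smul, inv_mul_cancel₀ ha, one_smul]
  rw [h2, h1, smul_neg, smul_smul, neg_smul]

lemma mul_pos_of_segmentPos_subset {S : Set (ℙ ℝ W)} (f : W →ₗ[ℝ] ℝ)
    (hf : ∀ x ∈ S, f x.rep ≠ 0) {u v : W} (hu : u ≠ 0) (hv : v ≠ 0)
    (huS : Projectivization.mk ℝ u hu ∈ S) (hvS : Projectivization.mk ℝ v hv ∈ S)
    (huv : Projectivization.mk ℝ u hu ≠ Projectivization.mk ℝ v hv)
    (h : segmentPos u v ⊆ S) : 0 < f u * f v := by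
  have h1 : f u ≠ 0 := fun h0 => hf _ huS ((apply_rep_mk_eq_zero_iff f u hu).2 h0)
  have h2 : f v ≠ 0 := fun h0 => hf _ hvS ((apply_rep_mk_eq_zero_iff f v hv).2 h0)
  by_contra! hle
  -- The point of the line through `u` and `v` on which `f` vanishes; `hle` places it on the
  -- positive segment.
  have hne := smul_add_smul_ne_zero hu hv huv (a := f v) (b := -f u) h2
  refine hf _ (h ⟨f v, -f u, hne, by nlinarith, Or.inl h2, rfl⟩) ?_
  rw [apply_rep_mk_eq_zero_iff]
  simp
  ring

lemma mul_neg_of_segmentNeg_subset {S : Set (ℙ ℝ W)} (f : W →ₗ[ℝ] ℝ)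
    (hf : ∀ x ∈ S, f x.rep ≠ 0) {u v : W} (hu : u ≠ 0) (hv : v ≠ 0)
    (huS : Projectivization.mk ℝ u hu ∈ S) (hvS : Projectivization.mk ℝ v hv ∈ S)
    (huv : Projectivization.mk ℝ u hu ≠ Projectivization.mk ℝ v hv)
    (h : segmentNeg u v ⊆ S) : f u * f v < 0 := by
  have h1 : f u ≠ 0 := fun h0 => hf _ huS ((apply_rep_mk_eq_zero_iff f u hu).2 h0)
  have h2 : f v ≠ 0 := fun h0 => hf _ hvS ((apply_rep_mk_eq_zero_iff f v hv).2 h0)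
  by_contra! hle
  have hne := smul_add_smul_ne_zero hu hv huv (a := f v) (b := -f u) h2
  refine hf _ (h ⟨f v, -f u, hne, by nlinarith, Or.inl h2, rfl⟩) ?_
  rw [apply_rep_mk_eq_zero_iff]
  simp
  ring

lemma apply_ne_zero_of_mem_segmentPos (f : W →ₗ[ℝ] ℝ) {u v : W} (h : 0 < f u * f v)
    {x : ℙ ℝ W} (hx : x ∈ segmentPos u v) : f x.rep ≠ 0 := by
  obtain ⟨a, b, hne, hab, hor, rfl⟩ := hx
  rw [Ne, apply_rep_mk_eq_zero_iff]
  simp only [map_add, map_smul, smul_eq_mul]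
  intro h0
  have hu : f u ≠ 0 := left_ne_zero_of_mul h.ne'
  have hv : f v ≠ 0 := right_ne_zero_of_mul h.ne'
  -- The square of the vanishing value is a sum of three nonnegative terms, and one of the two
  -- squares is positive.
  have hsq : (a * f u) ^ 2 + (b * f v) ^ 2 + 2 * ((a * b) * (f u * f v)) = 0 := by
    linear_combination (a * f u + b * f v) * h0
  have hnn := mul_nonneg hab h.le
  rcases hor with ha | hb
  · have := pow_pos (abs_pos.2 (mul_ne_zero ha hu)) 2
    rw [sq_abs] at this
    nlinarith [sq_nonneg (b * f v)]
  · have := pow_pos (abs_pos.2 (mul_ne_zero hb hv)) 2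
    rw [sq_abs] at this
    nlinarith [sq_nonneg (a * f u)]

lemma segmentNeg_eq_segmentPos_neg (u v : W) : segmentNeg u v = segmentPos u (-v) := by
  ext x
  constructor
  · rintro ⟨a, b, hne, hab, hor, rfl⟩
    exact ⟨a, -b, by simpa using hne, by linarith, by simpa using hor, by simp⟩
  · rintro ⟨a, b, hne, hab, hor, rfl⟩
    exact ⟨a, -b, by simpa using hne, by linarith, by simpa using hor, by simp⟩

lemma apply_ne_zero_of_mem_segmentNeg (f : W →ₗ[ℝ] ℝ) {u v : W} (h : f u * f v < 0)
    {x : ℙ ℝ W} (hx : x ∈ segmentNeg u v) : f x.rep ≠ 0 := by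
  rw [segmentNeg_eq_segmentPos_neg] at hx
  exact apply_ne_zero_of_mem_segmentPos f (by rw [map_neg]; linarith) hx

/-! ### Convex sets, their intersections and relative hulls. -/

lemma IsConvex.exists_functional {S : Set (ℙ ℝ W)} (h : IsConvex S) :
    ∃ g : W →ₗ[ℝ] ℝ, g ≠ 0 ∧ ∀ x ∈ S, g x.rep ≠ 0 := by
  obtain ⟨-, h', hh, hd⟩ := h
  obtain ⟨g, hg, rfl⟩ := (isHyperplane_iff _).1 hh
  exact ⟨g, hg, fun x hx h0 => Set.disjoint_left.1 hd h0 hx⟩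

lemma isConvex_of_functional {S : Set (ℙ ℝ W)} (h : IsSemiconvex S) {g : W →ₗ[ℝ] ℝ}
    (hg : g ≠ 0) (hS : ∀ x ∈ S, g x.rep ≠ 0) : IsConvex S :=
  ⟨h, _, (isHyperplane_iff _).2 ⟨g, hg, rfl⟩, Set.disjoint_left.2 fun x hx hxS => hS x hxS hx⟩

lemma IsSemiconvex.singleton (p : ℙ ℝ W) : IsSemiconvex {p} :=
  fun _ _ _ _ h1 h2 h3 => absurd (h1.trans h2.symm) h3

lemma IsConvex.singleton (p : ℙ ℝ W) : IsConvex {p} := by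
  obtain ⟨f, hf⟩ : ∃ f : Module.Dual ℝ W, f p.rep ≠ 0 := by
    by_contra! h
    exact p.rep_nonzero ((Module.forall_dual_apply_eq_zero_iff ℝ p.rep).1 h)
  refine isConvex_of_functional (IsSemiconvex.singleton p) (g := f)
    (fun h0 => hf (by simp [h0])) ?_
  rintro x rfl
  exact hf

/-- Intersections of convex sets inside one convex set are convex. -/
lemma IsConvex.sInter {F : Set (Set (ℙ ℝ W))} {D : Set (ℙ ℝ W)} (hD : IsConvex D)
    (hF : F.Nonempty) (hFD : ∀ A ∈ F, IsConvex A ∧ A ⊆ D) : IsConvex (⋂₀ F) := by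
  obtain ⟨g, hg, hgD⟩ := hD.exists_functional
  obtain ⟨A₀, hA₀⟩ := hF
  refine isConvex_of_functional ?_ hg fun x hx => hgD x ((hFD A₀ hA₀).2 (hx A₀ hA₀))
  intro u v hu hv huF hvF huv
  -- One functional `g` serves every member of `F`, so its sign selects the same segment in all of
  -- them.
  have pos {A} (hA : A ∈ F) (h : segmentPos u v ⊆ A) : 0 < g u * g v :=
    mul_pos_of_segmentPos_subset g (fun x hx => hgD x ((hFD A hA).2 hx)) hu hv
      (huF A hA) (hvF A hA) huv h
  have neg {A} (hA : A ∈ F) (h : segmentNeg u v ⊆ A) : g u * g v < 0 :=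
    mul_neg_of_segmentNeg_subset g (fun x hx => hgD x ((hFD A hA).2 hx)) hu hv
      (huF A hA) (hvF A hA) huv h
  rcases lt_or_ge 0 (g u * g v) with h | h
  · exact Or.inl <| Set.subset_sInter fun A hA =>
      ((hFD A hA).1.1 u v hu hv (huF A hA) (hvF A hA) huv).resolve_right
        fun h' => absurd (neg hA h') h.not_gt
  · exact Or.inr <| Set.subset_sInter fun A hA =>
      ((hFD A hA).1.1 u v hu hv (huF A hA) (hvF A hA) huv).resolve_left
        fun h' => absurd (pos hA h') h.not_gt

lemma IsConvex.inter {A B D : Set (ℙ ℝ W)} (hD : IsConvex D) (hA : IsConvex A) (hB : IsConvex B)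
    (hAD : A ⊆ D) (hBD : B ⊆ D) : IsConvex (A ∩ B) := by
  rw [← Set.sInter_pair]
  refine hD.sInter (by simp) ?_
  rintro X (rfl | rfl)
  exacts [⟨hA, hAD⟩, ⟨hB, hBD⟩]

lemma relHull_isConvex {S D : Set (ℙ ℝ W)} (hD : IsConvex D) (hS : S ⊆ D) :
    IsConvex (relHull S D) :=
  hD.sInter ⟨D, hD, hS, subset_rfl⟩ fun _ hA => ⟨hA.1, hA.2.2⟩

lemma subset_relHull (S D : Set (ℙ ℝ W)) : S ⊆ relHull S D :=
  Set.subset_sInter fun _ hA => hA.2.1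

lemma relHull_subset {S D N : Set (ℙ ℝ W)} (hN : IsConvex N) (hS : S ⊆ N) (hD : N ⊆ D) :
    relHull S D ⊆ N :=
  Set.sInter_subset_of_mem ⟨hN, hS, hD⟩

lemma relHull_mem_coComp {S D : Set (ℙ ℝ W)} (hD : IsConvex D) (hS : S ⊆ D) :
    relHull S D ∈ coComp S :=
  ⟨⟨relHull_isConvex hD hS, subset_relHull S D⟩, fun _ hA hle =>
    relHull_subset hA.1 hA.2 (hle.trans (relHull_subset hD hS subset_rfl))⟩

/-! ### Convexity of polar sets and irreducibility of hyperplane complements. -/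

/-- The points of `ℙ(W')` not orthogonal to any point of `S` under a bilinear pairing. -/
def nonOrthogonal (B : W →ₗ[ℝ] W' →ₗ[ℝ] ℝ) (S : Set (ℙ ℝ W)) : Set (ℙ ℝ W') :=
  {q | ∀ p ∈ S, B p.rep q.rep ≠ 0}

/-- Two functionals `u`, `v` vanishing nowhere on `S` have a ratio of constant sign there: for `x`,
`y` in `S`, the segment inside `S` determines the sign of both `u(x)u(y)` and `v(x)v(y)`. This
common sign chooses the segment from `u` to `v`. -/
lemma isSemiconvex_nonOrthogonal (B : W →ₗ[ℝ] W' →ₗ[ℝ] ℝ) {S : Set (ℙ ℝ W)}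
    (hS : IsSemiconvex S) : IsSemiconvex (nonOrthogonal B S) := by
  intro u v hu hv huS hvS _
  have ne_u : ∀ x ∈ S, B.flip u x.rep ≠ 0 := fun x hx h0 =>
    huS x hx ((apply_rep_mk_eq_zero_iff (B x.rep) u hu).2 h0)
  have ne_v : ∀ x ∈ S, B.flip v x.rep ≠ 0 := fun x hx h0 =>
    hvS x hx ((apply_rep_mk_eq_zero_iff (B x.rep) v hv).2 h0)
  have key : ∀ x ∈ S, ∀ y ∈ S,
      0 < (B x.rep u * B x.rep v) * (B y.rep u * B y.rep v) := by
    intro x hx y hy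
    by_cases hxy : x = y
    · subst hxy
      exact mul_self_pos.2 (mul_ne_zero (ne_u x hx) (ne_v x hx))
    have hx' : Projectivization.mk ℝ x.rep x.rep_nonzero ∈ S := by simpa using hx
    have hy' : Projectivization.mk ℝ y.rep y.rep_nonzero ∈ S := by simpa using hy
    have hne : Projectivization.mk ℝ x.rep x.rep_nonzero ≠
      Projectivization.mk ℝ y.rep y.rep_nonzero := by simpa using hxy
    -- Regroup the factors by functional instead of by point.
    rw [mul_mul_mul_comm]
    rcases hS _ _ x.rep_nonzero y.rep_nonzero hx' hy' hne with h | h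
    · exact mul_pos
        (mul_pos_of_segmentPos_subset _ ne_u x.rep_nonzero y.rep_nonzero hx' hy' hne h)
        (mul_pos_of_segmentPos_subset _ ne_v x.rep_nonzero y.rep_nonzero hx' hy' hne h)
    · exact mul_pos_of_neg_of_neg
        (mul_neg_of_segmentNeg_subset _ ne_u x.rep_nonzero y.rep_nonzero hx' hy' hne h)
        (mul_neg_of_segmentNeg_subset _ ne_v x.rep_nonzero y.rep_nonzero hx' hy' hne h)
  by_cases h : ∃ x ∈ S, 0 < B x.rep u * B x.rep v
  · obtain ⟨x, hx, hpos⟩ := h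
    exact Or.inl fun q hq y hy => apply_ne_zero_of_mem_segmentPos (B y.rep)
      (pos_of_mul_pos_right (key x hx y hy) hpos.le) hq
  · push Not at h
    exact Or.inr fun q hq y hy => apply_ne_zero_of_mem_segmentNeg (B y.rep)
      (lt_of_le_of_ne (h y hy) (mul_ne_zero (ne_u y hy) (ne_v y hy))) hq

lemma isConvex_nonOrthogonal {B : W →ₗ[ℝ] W' →ₗ[ℝ] ℝ} (hB : Function.Injective B)
    {S : Set (ℙ ℝ W)} (hS : IsSemiconvex S) (hne : S.Nonempty) :
    IsConvex (nonOrthogonal B S) := by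
  obtain ⟨p, hp⟩ := hne
  exact isConvex_of_functional (isSemiconvex_nonOrthogonal B hS)
    ((map_ne_zero_iff B hB).2 p.rep_nonzero) fun q hq => hq p hp

lemma isIrreducibleConvex_setOf_ne_zero {g : W →ₗ[ℝ] ℝ} (hg : g ≠ 0) :
    IsIrreducibleConvex {x : ℙ ℝ W | g x.rep ≠ 0} := by
  -- A convex `B` containing the complement of `ker g` avoids some `ker g'`. Then `ker g' ⊆ ker g`,
  -- so `g` is a nonzero multiple of `g'` and `B` is no larger.
  have maximal {B : Set (ℙ ℝ W)} (hB : IsConvex B) (h : {x : ℙ ℝ W | g x.rep ≠ 0} ⊆ B) :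
      {x : ℙ ℝ W | g x.rep ≠ 0} = B := by
    refine h.antisymm fun x hx hgx => ?_
    obtain ⟨g', hg', hB'⟩ := hB.exists_functional
    obtain ⟨x₀, hx₀⟩ := LinearMap.surjective hg' 1
    have ker_le (y : W) (hy : g' y = 0) : g y = 0 := by
      by_contra hgy
      have hy0 : y ≠ 0 := fun h0 => hgy (by simp [h0])
      have hmem : Projectivization.mk ℝ y hy0 ∈ B :=
        h fun h0 => hgy ((apply_rep_mk_eq_zero_iff g y hy0).1 h0)
      exact hB' _ hmem ((apply_rep_mk_eq_zero_iff g' y hy0).2 hy)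
    have formula (y : W) : g y = g' y * g x₀ := by
      have := ker_le (y - g' y • x₀) (by simp [hx₀])
      rw [map_sub, map_smul, smul_eq_mul] at this
      linarith
    have hgx₀ : g x₀ ≠ 0 := fun h0 => hg (LinearMap.ext fun y => by simp [formula y, h0])
    have := formula x.rep
    rw [hgx] at this
    exact mul_ne_zero (hB' x hx) hgx₀ this.symm
  refine ⟨isConvex_of_functional ?_ hg fun x hx => hx, fun B C hB hC h => Or.inl ?_⟩
  · intro u v hu hv hgu hgv _
    have h1 : g u ≠ 0 := fun h0 => hgu ((apply_rep_mk_eq_zero_iff g u hu).2 h0)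
    have h2 : g v ≠ 0 := fun h0 => hgv ((apply_rep_mk_eq_zero_iff g v hv).2 h0)
    rcases (mul_ne_zero h1 h2).lt_or_gt with h | h
    · exact Or.inr fun x hx => apply_ne_zero_of_mem_segmentNeg g h hx
    · exact Or.inl fun x hx => apply_ne_zero_of_mem_segmentPos g h hx
  · exact maximal hB (h.trans_subset Set.inter_subset_left)

/-! ### Separation by Hahn–Banach. -/

/-- A point outside an open convex set lies on a hyperplane avoiding that set. -/
lemma IsConvex.exists_functional_of_isOpen [TopologicalSpace W] [IsTopologicalAddGroup W]
    [ContinuousSMul ℝ W] [T2Space W] [FiniteDimensional ℝ W] {U : Set (ℙ ℝ W)}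
    (hU : IsConvex U) (hopen : IsOpen U) (hne : U.Nonempty) {p : ℙ ℝ W} (hp : p ∉ U) :
    ∃ f : W →ₗ[ℝ] ℝ, f ≠ 0 ∧ f p.rep = 0 ∧ ∀ x ∈ U, f x.rep ≠ 0 := by
  obtain ⟨g, hg, hgU⟩ := hU.exists_functional
  -- The cone over `U` has two opposite halves; the condition `0 < g v` keeps one, which is an
  -- honest convex set.
  let K : Set W := {v | 0 < g v ∧ ∃ hv : v ≠ 0, Projectivization.mk ℝ v hv ∈ U}
  have hKopen : IsOpen K := by
    have h1 : IsOpen {v | 0 < g v} :=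
      isOpen_lt continuous_const (LinearMap.continuous_of_finiteDimensional g)
    have h2 : IsOpen {v : W | ∃ hv : v ≠ 0, Projectivization.mk ℝ v hv ∈ U} := by
      have h3 : IsOpen ((Projectivization.mk' ℝ : {w : W // w ≠ 0} → ℙ ℝ W) ⁻¹' U) :=
        isOpen_coinduced.1 hopen
      have h4 := isOpen_ne.isOpenMap_subtype_val _ h3
      convert h4 using 1
      ext v
      constructor
      · rintro ⟨hv, h⟩
        exact ⟨⟨v, hv⟩, h, rfl⟩
      · rintro ⟨⟨w, hw⟩, h, rfl⟩
        exact ⟨hw, h⟩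
    exact h1.inter h2
  have hKconv : Convex ℝ K := by
    rintro u ⟨hgu, hu, huU⟩ v ⟨hgv, hv, hvU⟩ a b ha hb hab
    have hpos : 0 < g (a • u + b • v) := by
      simp only [map_add, map_smul, smul_eq_mul]
      rcases ha.eq_or_lt with rfl | ha
      · have : b = 1 := by linarith
        simpa [this] using hgv
      · exact add_pos_of_pos_of_nonneg (mul_pos ha hgu) (mul_nonneg hb hgv.le)
    have hne' : a • u + b • v ≠ 0 := fun h0 => by simp [h0] at hpos
    refine ⟨hpos, hne', ?_⟩
    -- Segments are only provided between distinct points, so proportional vectors are treated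
    -- apart.
    by_cases huv : Projectivization.mk ℝ u hu = Projectivization.mk ℝ v hv
    · obtain ⟨c, hc⟩ := (Projectivization.mk_eq_mk_iff' ℝ u v hu hv).1 huv
      convert hvU using 1
      rw [Projectivization.mk_eq_mk_iff']
      exact ⟨a * c + b, by rw [add_smul, mul_smul, hc]⟩
    · rcases hU.1 u v hu hv huU hvU huv with h | h
      · refine h ⟨a, b, hne', mul_nonneg ha hb, ?_, rfl⟩
        by_contra! h0
        simp [h0.1, h0.2] at hab
      · exact absurd (mul_neg_of_segmentNeg_subset g hgU hu hv huU hvU huv h)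
          (mul_pos hgu hgv).not_gt
  have hdisj : Disjoint K (Submodule.span ℝ {p.rep} : Set W) := by
    rw [Set.disjoint_left]
    rintro v ⟨-, hv, hvU⟩ hmem
    obtain ⟨c, hc⟩ := Submodule.mem_span_singleton.1 hmem
    apply hp
    rw [← p.mk_rep]
    convert hvU using 1
    exact ((Projectivization.mk_eq_mk_iff' ℝ v p.rep hv p.rep_nonzero).2 ⟨c, hc⟩).symm
  obtain ⟨f, s, hfK, hfp⟩ :=
    geometric_hahn_banach_open hKconv hKopen (Submodule.convex _) hdisj
  have hs : s ≤ 0 := by simpa using hfp 0 (Submodule.zero_mem _)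
  -- A functional bounded below on a line vanishes there: the multiple of `p.rep` used would have
  -- value `s - 1 < s`.
  have hfp0 : f p.rep = 0 := by
    by_contra h0
    have := hfp (((s - 1) / f p.rep) • p.rep)
      (Submodule.smul_mem _ _ (Submodule.mem_span_singleton_self _))
    rw [map_smul, smul_eq_mul, div_mul_cancel₀ _ h0] at this
    linarith
  have hfU : ∀ x ∈ U, f x.rep ≠ 0 := by
    intro x hx h0
    have hmk (c : ℝ) (hc : c ≠ 0) :
        Projectivization.mk ℝ (c • x.rep) (smul_ne_zero hc x.rep_nonzero) ∈ U := by
      convert hx using 1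
      conv_rhs => rw [← x.mk_rep]
      exact (Projectivization.mk_eq_mk_iff' ℝ _ _ _ _).2 ⟨c, rfl⟩
    -- Scaling by `g x.rep` moves the representative into the half `K`, where `f < s ≤ 0`.
    have := hfK (g x.rep • x.rep) ⟨by
      rw [map_smul, smul_eq_mul]
      exact mul_self_pos.2 (hgU x hx), smul_ne_zero (hgU x hx) x.rep_nonzero, hmk _ (hgU x hx)⟩
    rw [map_smul, h0, smul_zero] at this
    linarith
  refine ⟨f, fun h0 => ?_, hfp0, hfU⟩
  obtain ⟨x, hx⟩ := hne
  exact hfU x hx (LinearMap.congr_fun h0 x.rep)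

end General

/-! ### The polarity between subsets of `ℙ(V)` and of `ℙ(V*)`. -/

section Duality

variable {V : Type*} [AddCommGroup V] [Module ℝ V]

lemma incident_iff (p : ℙ ℝ V) (q : ℙ ℝ (Module.Dual ℝ V)) :
    Incident p q ↔ q.rep p.rep = 0 := by
  constructor
  · refine fun h => h _ ?_ _ ?_ <;>
    · rw [Projectivization.submodule_eq]
      exact Submodule.mem_span_singleton_self _
  · intro h v hv f hf
    rw [Projectivization.submodule_eq, Submodule.mem_span_singleton] at hv hf
    obtain ⟨a, rfl⟩ := hv
    obtain ⟨b, rfl⟩ := hf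
    simp [h]

lemma phi_eq (S : Set (ℙ ℝ V)) : Phi S = nonOrthogonal (Module.Dual.eval ℝ V) S := by
  ext q
  constructor
  · rintro ⟨C, -, hS, rfl⟩ p hp h0
    exact hS hp ((incident_iff p q).2 h0)
  · intro h
    refine ⟨_, ?_, fun p hp h0 => h p hp ((incident_iff p q).1 h0), rfl⟩
    simp only [incident_iff]
    exact isIrreducibleConvex_setOf_ne_zero q.rep_nonzero

lemma phiDual_eq (T : Set (ℙ ℝ (Module.Dual ℝ V))) :
    PhiDual T = nonOrthogonal LinearMap.id T := by
  ext p
  constructor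
  · rintro ⟨C, -, hT, rfl⟩ q hq h0
    exact hT hq ((incident_iff p q).2 h0)
  · intro h
    refine ⟨_, ?_, fun q hq h0 => h q hq ((incident_iff p q).1 h0), rfl⟩
    simp only [incident_iff]
    exact isIrreducibleConvex_setOf_ne_zero (g := Module.Dual.eval ℝ V p.rep)
      ((map_ne_zero_iff _ (Module.eval_apply_injective ℝ)).2 p.rep_nonzero)

lemma subset_phi_iff {S : Set (ℙ ℝ V)} {T : Set (ℙ ℝ (Module.Dual ℝ V))} :
    T ⊆ Phi S ↔ S ⊆ PhiDual T := by
  rw [phi_eq, phiDual_eq]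
  exact ⟨fun h p hp q hq => h hq p hp, fun h q hq p hp => h hp q hq⟩

lemma subset_phiDual_phi (S : Set (ℙ ℝ V)) : S ⊆ PhiDual (Phi S) :=
  subset_phi_iff.1 subset_rfl

lemma subset_satDual (T : Set (ℙ ℝ (Module.Dual ℝ V))) : T ⊆ satDual T :=
  subset_phi_iff.2 subset_rfl

lemma phi_anti {S S' : Set (ℙ ℝ V)} (h : S ⊆ S') : Phi S' ⊆ Phi S :=
  subset_phi_iff.2 (h.trans (subset_phiDual_phi S'))

lemma phiDual_anti {T T' : Set (ℙ ℝ (Module.Dual ℝ V))} (h : T ⊆ T') : PhiDual T' ⊆ PhiDual T :=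
  subset_phi_iff.1 (h.trans (subset_satDual T'))

lemma phiDual_satDual (T : Set (ℙ ℝ (Module.Dual ℝ V))) : PhiDual (satDual T) = PhiDual T :=
  (phiDual_anti (subset_satDual T)).antisymm (subset_phiDual_phi _)

lemma isConvex_phi {S : Set (ℙ ℝ V)} (hS : IsConvex S) (hne : S.Nonempty) : IsConvex (Phi S) := by
  rw [phi_eq]
  exact isConvex_nonOrthogonal (Module.eval_apply_injective ℝ) hS.1 hne

lemma isConvex_phiDual {T : Set (ℙ ℝ (Module.Dual ℝ V))} (hT : IsConvex T) (hne : T.Nonempty) :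
    IsConvex (PhiDual T) := by
  rw [phiDual_eq]
  exact isConvex_nonOrthogonal Function.injective_id hT.1 hne

lemma phi_nonempty {S : Set (ℙ ℝ V)} (hS : IsConvex S) : (Phi S).Nonempty := by
  obtain ⟨g, hg, hgS⟩ := hS.exists_functional
  rw [phi_eq]
  exact ⟨Projectivization.mk ℝ g hg, fun p hp h0 => hgS p hp
    ((apply_rep_mk_eq_zero_iff (Module.Dual.eval ℝ V p.rep) g hg).1 h0)⟩

lemma phiDual_nonempty [FiniteDimensional ℝ V] {T : Set (ℙ ℝ (Module.Dual ℝ V))}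
    (hT : IsConvex T) : (PhiDual T).Nonempty := by
  obtain ⟨g, hg, hgT⟩ := hT.exists_functional
  obtain ⟨v, rfl⟩ := (Module.evalEquiv ℝ V).surjective g
  have hv : v ≠ 0 := fun h => hg (by simp [h])
  rw [phiDual_eq]
  exact ⟨Projectivization.mk ℝ v hv, fun q hq h0 => hgT q hq
    ((apply_rep_mk_eq_zero_iff q.rep v hv).1 h0)⟩

/-- Polarity turns the union of the points of `S` into the intersection of the convex sets `Phi
{p}`. -/
lemma isMultiConvex_phi {S : Set (ℙ ℝ V)} (hS : S.Nonempty) : IsMultiConvex (Phi S) := by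
  refine ⟨(fun p => Phi {p}) '' S, hS.image _, ?_, ?_⟩
  · rintro _ ⟨p, -, rfl⟩
    exact isConvex_phi (IsConvex.singleton p) (Set.singleton_nonempty p)
  · ext q
    simp [phi_eq, nonOrthogonal]

/-- Singletons are convex, so the empty set is not maximal. -/
lemma nonempty_of_mem_comp {C N : Set (ℙ ℝ V)} (hC : C.Nonempty) (hN : N ∈ comp C) :
    N.Nonempty := by
  obtain ⟨p, hp⟩ := hC
  by_contra! h
  subst h
  exact hN.2 ⟨IsConvex.singleton p, Set.singleton_subset_iff.2 hp⟩ (Set.empty_subset _)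
    (Set.mem_singleton p)

lemma IsMultiConvex.phi_nonempty {C : Set (ℙ ℝ V)} (hC : IsMultiConvex C) : (Phi C).Nonempty := by
  obtain ⟨F, ⟨A, hA⟩, hF, rfl⟩ := hC
  exact (ProjConvex.phi_nonempty (hF A hA)).mono (phi_anti (Set.sInter_subset_of_mem hA))

lemma IsSaturatedMultiConvex.phiDual_phi [FiniteDimensional ℝ V] [TopologicalSpace V]
    [IsTopologicalAddGroup V] [ContinuousSMul ℝ V] [T2Space V] {C : Set (ℙ ℝ V)}
    (hC : C.Nonempty) (hsat : IsSaturatedMultiConvex C) : PhiDual (Phi C) = C := by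
  refine Set.Subset.antisymm (fun p hp => ?_) (subset_phiDual_phi C)
  by_contra hpC
  obtain ⟨U, hUo, hU, hCU, hpU⟩ := hsat.2 p hpC
  obtain ⟨f, hf, hfp, hfU⟩ := hU.exists_functional_of_isOpen hUo (hC.mono hCU) hpU
  rw [phiDual_eq, phi_eq] at hp
  -- The separating functional is a point of `Phi C` incident to `p`.
  refine hp (Projectivization.mk ℝ f hf) (fun x hx h0 => hfU x (hCU hx) ?_) ?_
  · exact (apply_rep_mk_eq_zero_iff (Module.Dual.eval ℝ V x.rep) f hf).1 h0
  · exact (apply_rep_mk_eq_zero_iff (Module.Dual.eval ℝ V p.rep) f hf).2 hfp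

/-- Components of a set closed under double duality are closed under double duality. -/
lemma phiDual_eq_of_mem_comp {C N : Set (ℙ ℝ V)} (hC : PhiDual (Phi C) = C)
    (hN : N ∈ comp C) {M : Set (ℙ ℝ (Module.Dual ℝ V))} (hM : IsConvex M) (hne : M.Nonempty)
    (hCM : Phi C ⊆ M) (hMN : M ⊆ Phi N) : PhiDual M = N :=
  have hle : N ⊆ PhiDual M := subset_phi_iff.1 hMN
  (hN.2 ⟨isConvex_phiDual hM hne, (phiDual_anti hCM).trans_eq hC⟩ hle).antisymm hle

lemma phiDual_mem_comp [FiniteDimensional ℝ V] {C : Set (ℙ ℝ V)} (hC : PhiDual (Phi C) = C)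
    (hne : (Phi C).Nonempty) {M : Set (ℙ ℝ (Module.Dual ℝ V))} (hM : M ∈ coComp (Phi C)) :
    PhiDual M ∈ comp C := by
  have hMc := isConvex_phiDual hM.1.1 (hne.mono hM.1.2)
  have hMne := phiDual_nonempty hM.1.1
  refine ⟨⟨hMc, (phiDual_anti hM.1.2).trans_eq hC⟩, fun N hN hle => ?_⟩
  -- The common convex superset `satDual M` makes this intersection convex.
  have hMN := hM.2 ⟨(isConvex_phi hMc hMne).inter hM.1.1
    (isConvex_phi hN.1 (hMne.mono hle)) (subset_satDual M) (phi_anti hle),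
    Set.subset_inter hM.1.2 (phi_anti hN.2)⟩ Set.inter_subset_left
  exact subset_phi_iff.1 (hMN.trans Set.inter_subset_right)

/-- For `N = PhiDual M` the set `Phi N` is `satDual M` by definition, so this is one of the two
inverse identities. The hull is convex and lies between `D` and `M`, so minimality of `M` applies.
-/
lemma relHull_satDual [FiniteDimensional ℝ V] {D M : Set (ℙ ℝ (Module.Dual ℝ V))}
    (hne : D.Nonempty) (hM : M ∈ coComp D) : relHull D (satDual M) = M := by
  have hle : relHull D (satDual M) ⊆ M := relHull_subset hM.1.1 hM.1.2 (subset_satDual M)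
  have hconv : IsConvex (satDual M) :=
    isConvex_phi (isConvex_phiDual hM.1.1 (hne.mono hM.1.2)) (phiDual_nonempty hM.1.1)
  exact hle.antisymm (hM.2 ⟨relHull_isConvex hconv (hM.1.2.trans (subset_satDual M)),
    subset_relHull _ _⟩ hle)

end Duality

end ProjConvex

theorem mainTheorem4 {V : Type*} [AddCommGroup V] [Module ℝ V] [FiniteDimensional ℝ V]
    [TopologicalSpace V] [IsTopologicalAddGroup V] [ContinuousSMul ℝ V] [T2Space V]
    (C : Set (ℙ ℝ V)) (hC : C.Nonempty) (hsat : ProjConvex.IsSaturatedMultiConvex C) :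
    ProjConvex.IsMultiConvex (ProjConvex.Phi C) ∧
    (∀ N ∈ ProjConvex.comp C,
      ProjConvex.IsConvex (ProjConvex.Phi N) ∧ ProjConvex.Phi C ⊆ ProjConvex.Phi N) ∧
    Set.BijOn (fun N => ProjConvex.relHull (ProjConvex.Phi C) (ProjConvex.Phi N))
      (ProjConvex.comp C) (ProjConvex.coComp (ProjConvex.Phi C)) ∧
    Set.BijOn (fun M => ProjConvex.PhiDual (ProjConvex.satDual M))
      (ProjConvex.coComp (ProjConvex.Phi C)) (ProjConvex.comp C) ∧
    Set.InvOn (fun M => ProjConvex.PhiDual (ProjConvex.satDual M))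
      (fun N => ProjConvex.relHull (ProjConvex.Phi C) (ProjConvex.Phi N))
      (ProjConvex.comp C) (ProjConvex.coComp (ProjConvex.Phi C)) := by
  have hdd := hsat.phiDual_phi hC
  have hne := hsat.1.phi_nonempty
  have hconv : ∀ N ∈ ProjConvex.comp C,
      ProjConvex.IsConvex (ProjConvex.Phi N) ∧ ProjConvex.Phi C ⊆ ProjConvex.Phi N :=
    fun N hN => ⟨ProjConvex.isConvex_phi hN.1.1 (ProjConvex.nonempty_of_mem_comp hC hN),
      ProjConvex.phi_anti hN.1.2⟩
  have hmaps : Set.MapsTo (fun N => ProjConvex.relHull (ProjConvex.Phi C) (ProjConvex.Phi N))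
      (ProjConvex.comp C) (ProjConvex.coComp (ProjConvex.Phi C)) :=
    fun N hN => ProjConvex.relHull_mem_coComp (hconv N hN).1 (hconv N hN).2
  have hmaps' : Set.MapsTo (fun M => ProjConvex.PhiDual (ProjConvex.satDual M))
      (ProjConvex.coComp (ProjConvex.Phi C)) (ProjConvex.comp C) := by
    intro M hM
    simp only [ProjConvex.phiDual_satDual]
    exact ProjConvex.phiDual_mem_comp hdd hne hM
  have hinv : Set.InvOn (fun M => ProjConvex.PhiDual (ProjConvex.satDual M))
      (fun N => ProjConvex.relHull (ProjConvex.Phi C) (ProjConvex.Phi N))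
      (ProjConvex.comp C) (ProjConvex.coComp (ProjConvex.Phi C)) := by
    constructor
    · intro N hN
      obtain ⟨h1, h2⟩ := hconv N hN
      simp only [ProjConvex.phiDual_satDual]
      exact ProjConvex.phiDual_eq_of_mem_comp hdd hN (ProjConvex.relHull_isConvex h1 h2)
        (hne.mono (ProjConvex.subset_relHull _ _)) (ProjConvex.subset_relHull _ _)
        (ProjConvex.relHull_subset h1 h2 subset_rfl)
    · intro M hM
      simp only [ProjConvex.phiDual_satDual]
      exact ProjConvex.relHull_satDual hne hM
  exact ⟨ProjConvex.isMultiConvex_phi hC, hconv, hinv.bijOn hmaps hmaps',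
    hinv.symm.bijOn hmaps' hmaps, hinv⟩
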